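/- Let $R$ be an associative ring with identity. For a subset $X$ of a ring $S$ put $r_S(X)=\{s\in S : xs=0 \text{ for all } x\in X\}$ and $l_S(X)=\{s\in S : sx=0 \text{ for all } x\in X\}$. An element $a\in R$ is called reversible if, for every $b\in R$, $ba=0$ if and only if $ab=0$; the ring $R$ is called weakly reversible if for every nonzero $a\in R$ there is an integer $m>0$ such that $a^m$ is a nonzero reversible element of $R$. A ring $S$ is called right zip if every subset $X\subseteq S$ with $r_S(X)=\{0\}$ has a finite subset $Y\subseteq X$ with $r_S(Y)=\{0\}$, left zip if the same holds with $l_S$ in place of $r_S$, and zip if it is both right zip and left zip. If $R$ is weakly reversible, then the polynomial ring $R[x]$ (with $x$ commuting with the elements of $R$) is zip if and only if $R$ is zip. -/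

import Mathlib

open Polynomial

/-- The right annihilator `r_R(X) = {r : x r = 0 for all x in X}` of a subset `X` of a ring. -/
def rightAnn {R : Type*} [Ring R] (X : Set R) : Set R := {r | ∀ x ∈ X, x * r = 0}

/-- The left annihilator `l_R(X) = {r : r x = 0 for all x in X}` of a subset `X` of a ring. -/
def leftAnn {R : Type*} [Ring R] (X : Set R) : Set R := {r | ∀ x ∈ X, r * x = 0}

/-- An element `a` is reversible if, for each `b`, `b` lies in `l_R(a)` iff it lies in `r_R(a)`. -/
def IsReversibleElem {R : Type*} [Ring R] (a : R) : Prop :=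
  ∀ b : R, b ∈ leftAnn {a} ↔ b ∈ rightAnn {a}

/-- A ring is weakly reversible if every nonzero element has a power, with positive exponent,
that is a nonzero reversible element. -/
def IsWeaklyReversible (R : Type*) [Ring R] : Prop :=
  ∀ a : R, a ≠ 0 → ∃ m : ℕ, 0 < m ∧ a ^ m ≠ 0 ∧ IsReversibleElem (a ^ m)

/-- A ring is right zip if every subset with zero right annihilator has a finite subset with
zero right annihilator. -/
def IsRightZip (R : Type*) [Ring R] : Prop :=
  ∀ X : Set R, rightAnn X = {0} → ∃ Y : Set R, Y ⊆ X ∧ Y.Finite ∧ rightAnn Y = {0}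

/-- A ring is left zip if every subset with zero left annihilator has a finite subset with
zero left annihilator. -/
def IsLeftZip (R : Type*) [Ring R] : Prop :=
  ∀ X : Set R, leftAnn X = {0} → ∃ Y : Set R, Y ⊆ X ∧ Y.Finite ∧ leftAnn Y = {0}

/-- A ring is zip if it is both right zip and left zip. -/
def IsZip (R : Type*) [Ring R] : Prop := IsRightZip R ∧ IsLeftZip R

/-! The crux is a McCoy property, `IsWeaklyReversible.exists_const_of_mul_eq_zero`: finitely many
polynomials with a common nonzero right annihilator have a nonzero constant one. Given it, a finite
set of coefficients with zero right annihilator lifts to finitely many polynomials with the same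
property. Weak reversibility passes to the opposite ring, which gives the left-hand half; descent to
`R` uses constant polynomials. For McCoy, take an annihilator of least degree `n`: multiplying it on
the right by a scalar that kills its `n`-th coefficient kills all of it. Reversibility lets scalars
change sides, and square-zero elements are always reversible. -/

theorem isReversibleElem_iff {R : Type*} [Ring R] {a : R} :
    IsReversibleElem a ↔ ∀ b : R, b * a = 0 ↔ a * b = 0 := by
  simp [IsReversibleElem, leftAnn, rightAnn]

theorem IsReversibleElem.mul_eq_zero_comm {R : Type*} [Ring R] {a : R} (ha : IsReversibleElem a)
    (b : R) : b * a = 0 ↔ a * b = 0 :=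
  isReversibleElem_iff.1 ha b

theorem IsReversibleElem.pow {R : Type*} [Ring R] {a : R} (ha : IsReversibleElem a) (k : ℕ) :
    IsReversibleElem (a ^ k) := by
  rw [isReversibleElem_iff]
  induction k with
  | zero => simp
  | succ k ih =>
    intro b
    rw [pow_succ', ← mul_assoc, ih, ← mul_assoc, ha.mul_eq_zero_comm, mul_assoc]

/-- In a weakly reversible ring the elements of square zero are reversible. -/
theorem IsWeaklyReversible.isReversibleElem_of_mul_self {R : Type*} [Ring R]
    (hR : IsWeaklyReversible R) {c : R} (hc : c * c = 0) : IsReversibleElem c := by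
  by_cases h0 : c = 0
  · simp [isReversibleElem_iff, h0]
  obtain ⟨m, hm, hne, hrev⟩ := hR c h0
  have hm1 : m = 1 := by
    by_contra h
    obtain ⟨k, rfl⟩ : ∃ k, m = k + 2 := ⟨m - 2, by omega⟩
    exact hne (by rw [pow_add, pow_two, hc, mul_zero])
  simpa [hm1] using hrev

theorem IsWeaklyReversible.mul_mul_self {R : Type*} [Ring R]
    (hR : IsWeaklyReversible R) {c : R} (hc : c * c = 0) (r : R) : c * r * c = 0 := by
  have h := hR.isReversibleElem_of_mul_self hc
  rw [mul_assoc, ← h.mul_eq_zero_comm, mul_assoc, hc, mul_zero]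

/-- The polynomials of degree at most `n` that are annihilated on the left by all of `Y`. -/
def boundedRightAnn {R : Type*} [Ring R] (Y : Set R[X]) (n : ℕ) : Set R[X] :=
  {h | (∀ f ∈ Y, f * h = 0) ∧ ∀ i, n < i → h.coeff i = 0}

theorem mul_C_mem_boundedRightAnn {R : Type*} [Ring R] {Y : Set R[X]} {n : ℕ} {h : R[X]}
    (hh : h ∈ boundedRightAnn Y n) (r : R) : h * C r ∈ boundedRightAnn Y n :=
  ⟨fun f hf => by rw [← mul_assoc, hh.1 f hf, zero_mul],
    fun i hi => by rw [coeff_mul_C, hh.2 i hi, zero_mul]⟩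

/-- Only one term survives in the coefficient of `f * h` of degree `i + n`. -/
theorem coeff_mul_coeff_top_eq_zero {R : Type*} [Ring R] {f h : R[X]} {n i : ℕ}
    (hfh : f * h = 0) (hh : ∀ j, n < j → h.coeff j = 0)
    (hi : ∀ k, i < k → ∀ j, f.coeff k * h.coeff j = 0) : f.coeff i * h.coeff n = 0 := by
  have h1 : (f * h).coeff (i + n) = 0 := by rw [hfh, coeff_zero]
  rw [coeff_mul, Finset.sum_eq_single (i, n)] at h1
  · exact h1
  · rintro ⟨p, q⟩ hpq hne
    rw [Finset.HasAntidiagonal.mem_antidiagonal] at hpq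
    dsimp only at hpq ⊢
    rcases lt_trichotomy p i with hp | hp | hp
    · rw [hh q (by omega), mul_zero]
    · exact absurd (Prod.ext hp (by dsimp only; omega)) hne
    · exact hi p hp q
  · simp

section Minimal

variable {R : Type*} [Ring R] {Y : Set R[X]} {n : ℕ}

/-- Downward induction on `i`: `f.coeff i` kills `h.coeff n` from the left, hence from the right; by
minimality it then kills `h` from the right, and reversibility moves it back. -/
theorem coeff_mul_coeff_eq_zero_of_isReversibleElem
    (hmin : ∀ h ∈ boundedRightAnn Y n, h.coeff n = 0 → h = 0) {h : R[X]}
    (hh : h ∈ boundedRightAnn Y n) (hrev : ∀ j, IsReversibleElem (h.coeff j)) {f : R[X]}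
    (hf : f ∈ Y) (i j : ℕ) : f.coeff i * h.coeff j = 0 := by
  suffices H : ∀ t i, f.natDegree < i + t → ∀ j, f.coeff i * h.coeff j = 0 from
    H (f.natDegree + 1) i (by omega) j
  intro t
  induction t with
  | zero => intro i hi j; rw [coeff_eq_zero_of_natDegree_lt (by omega), zero_mul]
  | succ t ih =>
    intro i hi j
    have h1 := coeff_mul_coeff_top_eq_zero (hh.1 f hf) hh.2
      (fun k hk => ih k (by omega) : ∀ k, i < k → _)
    have h2 : h * C (f.coeff i) = 0 := hmin _ (mul_C_mem_boundedRightAnn hh _) (by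
      rw [coeff_mul_C, ← (hrev n).mul_eq_zero_comm, h1])
    rw [(hrev j).mul_eq_zero_comm, ← coeff_mul_C, h2, coeff_zero]

/-- If multiplication by square-zero elements kills `g`, then multiplying `g` by powers of its
reversible leading coefficient successively makes the coefficients of `f` annihilate it. -/
theorem coeff_mul_coeff_mul_pow_eq_zero
    (hmin : ∀ h ∈ boundedRightAnn Y n, h.coeff n = 0 → h = 0) {g : R[X]}
    (hg : g ∈ boundedRightAnn Y n) (hrev : IsReversibleElem (g.coeff n))
    (hsq : ∀ r : R, r * r = 0 → g * C r = 0) {f : R[X]} (hf : f ∈ Y) (t : ℕ) :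
    ∀ i, f.natDegree < i + t → ∀ j, f.coeff i * (g.coeff j * g.coeff n ^ t) = 0 := by
  induction t with
  | zero => intro i hi j; rw [coeff_eq_zero_of_natDegree_lt (by omega), zero_mul]
  | succ t ih =>
    intro i hi j
    have hg' := mul_C_mem_boundedRightAnn hg (g.coeff n ^ t)
    have h1 := coeff_mul_coeff_top_eq_zero (i := i) (hg'.1 f hf) hg'.2
      (fun k hk j => by rw [coeff_mul_C]; exact ih k (by omega) j)
    rw [coeff_mul_C, ← pow_succ', (hrev.pow _).mul_eq_zero_comm] at h1
    have h2 : g * C (g.coeff n ^ t) * C (f.coeff i) = 0 :=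
      hmin _ (mul_C_mem_boundedRightAnn hg' _) (by
        rw [coeff_mul_C, coeff_mul_C, ← pow_succ', h1])
    have h3 : g.coeff j * g.coeff n ^ t * f.coeff i = 0 := by
      rw [← coeff_mul_C, ← coeff_mul_C, h2, coeff_zero]
    -- By `h3` this element has square zero, so `g` absorbs it; reversibility of `g.coeff n` then
    -- moves that factor to the right end.
    have h4 := hsq (f.coeff i * (g.coeff j * g.coeff n ^ t)) (by
      rw [mul_assoc, ← mul_assoc _ (f.coeff i), h3, zero_mul, mul_zero])
    have h5 : g.coeff n * (f.coeff i * (g.coeff j * g.coeff n ^ t)) = 0 := by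
      rw [← coeff_mul_C, h4, coeff_zero]
    rw [← hrev.mul_eq_zero_comm] at h5
    rw [pow_succ, ← mul_assoc (g.coeff j), ← mul_assoc, h5]

theorem exists_const_of_minimal (hR : IsWeaklyReversible R) (hY : Y.Finite)
    (hmin : ∀ h ∈ boundedRightAnn Y n, h.coeff n = 0 → h = 0) {g : R[X]}
    (hg : g ∈ boundedRightAnn Y n) (hg0 : g ≠ 0) :
    ∃ c : R, c ≠ 0 ∧ ∀ f ∈ Y, ∀ i, f.coeff i * c = 0 := by
  by_cases hex : ∃ h ∈ boundedRightAnn Y n, h ≠ 0 ∧ ∀ j, IsReversibleElem (h.coeff j)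
  · obtain ⟨h, hh, h0, hrev⟩ := hex
    exact ⟨h.coeff n, fun hc => h0 (hmin h hh hc), fun f hf i =>
      coeff_mul_coeff_eq_zero_of_isReversibleElem hmin hh hrev hf i n⟩
  -- Since `r * s * r = 0` for all `s`, the coefficients of `h * C r` have square zero and so are
  -- reversible, which `hex` excludes unless the product vanishes.
  have hsq : ∀ h ∈ boundedRightAnn Y n, ∀ r : R, r * r = 0 → h * C r = 0 := by
    intro h hh r hr
    by_contra hne
    refine hex ⟨_, mul_C_mem_boundedRightAnn hh r, hne, fun j =>
      hR.isReversibleElem_of_mul_self ?_⟩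
    rw [coeff_mul_C, mul_assoc, ← mul_assoc r, hR.mul_mul_self hr, mul_zero]
  obtain ⟨g, hg, hb0, hrev⟩ : ∃ g ∈ boundedRightAnn Y n, g.coeff n ≠ 0 ∧
      IsReversibleElem (g.coeff n) := by
    obtain ⟨m, hm, hne, hrev⟩ := hR (g.coeff n) fun hc => hg0 (hmin g hg hc)
    have hlead : (g * C (g.coeff n ^ (m - 1))).coeff n = g.coeff n ^ m := by
      rw [coeff_mul_C, ← pow_succ', Nat.sub_add_cancel hm]
    exact ⟨_, mul_C_mem_boundedRightAnn hg _, hlead ▸ hne, hlead ▸ hrev⟩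
  by_cases hnil : IsNilpotent (g.coeff n)
  · exfalso
    obtain ⟨h, hh, hb0, hb⟩ : ∃ h ∈ boundedRightAnn Y n, h.coeff n ≠ 0 ∧
        h.coeff n * h.coeff n = 0 := by
      have hlead : ∀ k, (g * C (g.coeff n ^ k)).coeff n = g.coeff n ^ (k + 1) := fun k => by
        rw [coeff_mul_C, ← pow_succ']
      obtain ⟨k, hk0, hk1⟩ : ∃ k, g.coeff n ^ (k + 1) ≠ 0 ∧ g.coeff n ^ (k + 2) = 0 := by
        by_contra! hall
        obtain ⟨N, hN⟩ := hnil
        have hne : ∀ k, g.coeff n ^ (k + 1) ≠ 0 := by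
          intro k
          induction k with
          | zero => simpa using hb0
          | succ k ih => exact hall k ih
        exact hne N (by rw [pow_succ, hN, zero_mul])
      refine ⟨_, mul_C_mem_boundedRightAnn hg (g.coeff n ^ k), hlead k ▸ hk0, ?_⟩
      rw [hlead, ← pow_add, show k + 1 + (k + 1) = k + 2 + k by ring, pow_add, hk1, zero_mul]
    -- Every coefficient of `h` has square zero: `hsq` and reversibility give `h.coeff n * h.coeff j
    -- = 0`, so `h * C (h.coeff j) = 0` by minimality.
    refine hex ⟨h, hh, fun h0 => hb0 (by rw [h0, coeff_zero]), fun j =>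
      hR.isReversibleElem_of_mul_self ?_⟩
    have h1 : h.coeff j * h.coeff n = 0 := by
      rw [← coeff_mul_C, hsq h hh _ hb, coeff_zero]
    rw [(hR.isReversibleElem_of_mul_self hb).mul_eq_zero_comm, ← coeff_mul_C] at h1
    rw [← coeff_mul_C, hmin _ (mul_C_mem_boundedRightAnn hh _) h1, coeff_zero]
  -- Finiteness of `Y` makes one exponent serve every `f`: `M + 1` factors exceed all degrees, and
  -- one more is the coefficient `g.coeff n` itself.
  · obtain ⟨M, hM⟩ := (hY.image natDegree).bddAbove
    refine ⟨g.coeff n ^ (M + 2), fun h0 => hnil ⟨_, h0⟩, fun f hf i => ?_⟩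
    have hfM : f.natDegree ≤ M := hM ⟨f, hf, rfl⟩
    rw [pow_succ']
    exact coeff_mul_coeff_mul_pow_eq_zero hmin hg hrev (hsq g hg) hf (M + 1) i (by omega) n

end Minimal

/-- McCoy's theorem for finite sets of polynomials over a weakly reversible ring. -/
theorem IsWeaklyReversible.exists_const_of_mul_eq_zero {R : Type*} [Ring R]
    (hR : IsWeaklyReversible R) {Y : Set R[X]} (hY : Y.Finite) {g : R[X]} (hg0 : g ≠ 0)
    (hg : ∀ f ∈ Y, f * g = 0) : ∃ c : R, c ≠ 0 ∧ ∀ f ∈ Y, ∀ i, f.coeff i * c = 0 := by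
  induction hd : g.natDegree using Nat.strong_induction_on generalizing g with
  | _ n ih =>
    by_cases hlt : ∃ h : R[X], h ≠ 0 ∧ (∀ f ∈ Y, f * h = 0) ∧ h.natDegree < n
    · obtain ⟨h, h0, hh, hdeg⟩ := hlt
      exact ih _ hdeg h0 hh rfl
    refine exists_const_of_minimal (n := n) hR hY (fun h hh hc => ?_)
      ⟨hg, fun i hi => coeff_eq_zero_of_natDegree_lt (hd ▸ hi)⟩ hg0
    by_contra h0
    refine hlt ⟨h, h0, hh.1, ?_⟩
    by_contra! hle
    have hlc : h.coeff h.natDegree = 0 := by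
      rcases hle.eq_or_lt with he | hl
      · rw [← he, hc]
      · exact hh.2 _ hl
    exact h0 (leadingCoeff_eq_zero.1 hlc)

theorem rightAnn_eq_zero_iff {R : Type*} [Ring R] {X : Set R} :
    rightAnn X = {0} ↔ ∀ r, (∀ x ∈ X, x * r = 0) → r = 0 := by
  simp only [Set.ext_iff, rightAnn, Set.mem_ofPred_eq, Set.mem_singleton_iff]
  exact ⟨fun h r => (h r).1, fun h r => ⟨h r, fun hr x _ => by rw [hr, mul_zero]⟩⟩

theorem leftAnn_eq_zero_iff {R : Type*} [Ring R] {X : Set R} :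
    leftAnn X = {0} ↔ ∀ r, (∀ x ∈ X, r * x = 0) → r = 0 := by
  simp only [Set.ext_iff, leftAnn, Set.mem_ofPred_eq, Set.mem_singleton_iff]
  exact ⟨fun h r => (h r).1, fun h r => ⟨h r, fun hr x _ => by rw [hr, zero_mul]⟩⟩

theorem IsRightZip.of_polynomial {R : Type*} [Ring R] (h : IsRightZip R[X]) : IsRightZip R := by
  intro X hX
  rw [rightAnn_eq_zero_iff] at hX
  obtain ⟨Y, hYX, hfin, hY⟩ := h (C '' X) (rightAnn_eq_zero_iff.2 fun g hg => by
    ext i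
    refine hX _ fun x hx => ?_
    rw [← coeff_C_mul, hg _ ⟨x, hx, rfl⟩, coeff_zero])
  obtain ⟨Z, hZX, hZfin, rfl⟩ := Set.exists_subset_image_finite_and.1 ⟨Y, hYX, hfin, rfl⟩
  rw [rightAnn_eq_zero_iff] at hY
  refine ⟨Z, hZX, hZfin, rightAnn_eq_zero_iff.2 fun r hr => C_eq_zero.1 (hY _ ?_)⟩
  rintro _ ⟨x, hx, rfl⟩
  rw [← C_mul, hr x hx, C_0]

theorem IsRightZip.polynomial {R : Type*} [Ring R] (hR : IsWeaklyReversible R)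
    (h : IsRightZip R) : IsRightZip R[X] := by
  intro X hX
  rw [rightAnn_eq_zero_iff] at hX
  obtain ⟨Y, hYX, hfin, hY⟩ := h {a | ∃ f ∈ X, ∃ i, f.coeff i = a}
    (rightAnn_eq_zero_iff.2 fun r hr => C_eq_zero.1 (hX _ fun f hf => by
      ext i
      rw [coeff_mul_C, coeff_zero]
      exact hr _ ⟨f, hf, i, rfl⟩))
  rw [rightAnn_eq_zero_iff] at hY
  -- Each coefficient in `Y` is traced back to a polynomial of `X` containing it.
  choose! F hFX hF using hYX
  refine ⟨F '' Y, Set.image_subset_iff.2 hFX, hfin.image F, rightAnn_eq_zero_iff.2 fun g hg => ?_⟩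
  by_contra hg0
  obtain ⟨c, hc0, hc⟩ := hR.exists_const_of_mul_eq_zero (hfin.image F) hg0 hg
  refine hc0 (hY c fun y hy => ?_)
  obtain ⟨i, hi⟩ := hF hy
  rw [← hi]
  exact hc _ ⟨y, hy, rfl⟩ i

theorem IsRightZip.of_ringEquiv {R S : Type*} [Ring R] [Ring S] (e : R ≃+* S)
    (h : IsRightZip R) : IsRightZip S := by
  intro X hX
  rw [rightAnn_eq_zero_iff] at hX
  obtain ⟨Y, hYX, hfin, hY⟩ := h (e ⁻¹' X) (rightAnn_eq_zero_iff.2 fun r hr => by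
    refine (map_eq_zero_iff e e.injective).1 (hX _ fun x hx => ?_)
    rw [← e.apply_symm_apply x, ← map_mul, hr _ (by simpa using hx), map_zero])
  rw [rightAnn_eq_zero_iff] at hY
  refine ⟨e '' Y, Set.image_subset_iff.2 hYX, hfin.image e, rightAnn_eq_zero_iff.2 fun s hs => ?_⟩
  refine (map_eq_zero_iff e.symm e.symm.injective).1 (hY _ fun y hy => e.injective ?_)
  rw [map_mul, e.apply_symm_apply, hs _ ⟨y, hy, rfl⟩, map_zero]

theorem isRightZip_mulOpposite_iff {R : Type*} [Ring R] : IsRightZip Rᵐᵒᵖ ↔ IsLeftZip R := by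
  constructor
  · intro h X hX
    rw [leftAnn_eq_zero_iff] at hX
    obtain ⟨Y, hYX, hfin, hY⟩ := h (MulOpposite.unop ⁻¹' X) (rightAnn_eq_zero_iff.2 fun r hr =>
      MulOpposite.unop_injective (hX _ fun x hx =>
        MulOpposite.op_injective (hr (MulOpposite.op x) hx)))
    rw [rightAnn_eq_zero_iff] at hY
    refine ⟨MulOpposite.unop '' Y, Set.image_subset_iff.2 hYX, hfin.image _,
      leftAnn_eq_zero_iff.2 fun r hr => MulOpposite.op_injective (hY _ fun y hy =>
        MulOpposite.unop_injective (hr _ ⟨y, hy, rfl⟩))⟩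
  · intro h X hX
    rw [rightAnn_eq_zero_iff] at hX
    obtain ⟨Y, hYX, hfin, hY⟩ := h (MulOpposite.op ⁻¹' X) (leftAnn_eq_zero_iff.2 fun r hr =>
      MulOpposite.op_injective (hX _ fun x hx =>
        MulOpposite.unop_injective (hr (MulOpposite.unop x) hx)))
    rw [leftAnn_eq_zero_iff] at hY
    refine ⟨MulOpposite.op '' Y, Set.image_subset_iff.2 hYX, hfin.image _,
      rightAnn_eq_zero_iff.2 fun r hr => MulOpposite.unop_injective (hY _ fun y hy =>
        MulOpposite.op_injective (hr _ ⟨y, hy, rfl⟩))⟩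

theorem IsWeaklyReversible.mulOpposite {R : Type*} [Ring R] (hR : IsWeaklyReversible R) :
    IsWeaklyReversible Rᵐᵒᵖ := by
  intro a ha
  obtain ⟨m, hm, hne, hrev⟩ := hR a.unop ((MulOpposite.unop_ne_zero_iff a).2 ha)
  refine ⟨m, hm, fun h => hne (by rw [← MulOpposite.unop_pow, h, MulOpposite.unop_zero]), ?_⟩
  rw [isReversibleElem_iff]
  intro b
  rw [← MulOpposite.unop_eq_zero_iff, ← MulOpposite.unop_eq_zero_iff (_ * b), MulOpposite.unop_mul,
    MulOpposite.unop_mul, MulOpposite.unop_pow, hrev.mul_eq_zero_comm]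

theorem mainTheorem3 {R : Type*} [Ring R] (hR : IsWeaklyReversible R) :
    IsZip R[X] ↔ IsZip R := by
  constructor
  · rintro ⟨hr, hl⟩
    refine ⟨hr.of_polynomial, isRightZip_mulOpposite_iff.1 (IsRightZip.of_polynomial ?_)⟩
    exact (isRightZip_mulOpposite_iff.2 hl).of_ringEquiv (opRingEquiv R)
  · rintro ⟨hr, hl⟩
    refine ⟨hr.polynomial hR, isRightZip_mulOpposite_iff.1 ?_⟩
    exact ((isRightZip_mulOpposite_iff.2 hl).polynomial hR.mulOpposite).of_ringEquiv
      (opRingEquiv R).symm
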